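/- Terminology. Let $k,n$ be positive integers and $0<\alpha\le 1$. A map between an open subset of $\mathbf R^n$ and $\mathbf R^n$ is of class $(k,\alpha)$ if it is $k$ times continuously differentiable and its $k$-th derivative locally satisfies a Hölder condition with exponent $\alpha$. A subset $B\subset\mathbf R^n$ is a submanifold of class $(k,\alpha)$ if, for some integer $0\le d\le n$, each $b\in B$ has an open neighbourhood $U$ admitting a homeomorphism $\phi$ of $U$ onto an open subset of $\mathbf R^n$, with $\phi$ and $\phi^{-1}$ of class $(k,\alpha)$, and a $d$-dimensional linear subspace $T$ with $\phi[B\cap U]=T\cap\phi[U]$. A set $G\subset\mathbf R^n$ is pointwise differentiable of order $(k,\alpha)$ at $c\in\mathbf R^n$ if there is a submanifold $B$ of class $(k,\alpha)$ of $\mathbf R^n$ with $c\in B$, $$\lim_{r\to0+}r^{-1}\sup\{|\operatorname{dist}(x,G)-\operatorname{dist}(x,B)|: |x-c|\le r\}=0,$$ $$\limsup_{r\to0+}r^{-k-\alpha}\sup\{\operatorname{dist}(x,B): x\in G,\ |x-c|\le r\}<\infty .$$ Statement. For all positive integers $k$ and $m$ there exist a closed set $A\subset\mathbf R^m$ with $\mathscr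 L^m(A)>0$ and a nonnegative function $f:\mathbf R^m\to\mathbf R$ of class $k$ (that is, $k$ times continuously differentiable) such that $D^if(a)=0$ for all $a\in A$ and $i=0,\dots,k$, and such that, for $\mathscr L^m$ almost all $a\in A$, $$\limsup_{x\to a}|x-a|^{-k-\alpha}f(x)=\infty\quad\text{for every }\alpha>0 .$$ Moreover, for every $0<\alpha\le1$, the graph $\{(x,f(x)):x\in\mathbf R^m\}\subset\mathbf R^{m+1}$ is not pointwise differentiable of order $(k,\alpha)$ at $c$ for $\mathscr H^m$ almost all $c\in\{(a,0):a\in A\}$. -/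

import Mathlib

open Set Filter Topology MeasureTheory

namespace PtDiff

/-- The map `f`, regarded as a map with domain `U`, is of class `k` (if `α = 0`) or of class
`(k, α)` (if `α > 0`): its domain is open, it is `k` times continuously differentiable there and,
if `α > 0`, its `k`-th derivative locally satisfies a Hölder condition with exponent `α`. -/
def IsOfClass {X Y : Type*} [NormedAddCommGroup X] [NormedSpace ℝ X]
    [NormedAddCommGroup Y] [NormedSpace ℝ Y] (k : ℕ) (α : ℝ) (f : X → Y) (U : Set X) : Prop :=
  IsOpen U ∧ ContDiffOn ℝ k f U ∧
    (0 < α → ∀ x ∈ U, ∃ V ∈ 𝓝 x, ∃ C : ℝ, ∀ y ∈ V ∩ U, ∀ z ∈ V ∩ U,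
      ‖iteratedFDeriv ℝ k f y - iteratedFDeriv ℝ k f z‖ ≤ C * ‖y - z‖ ^ α)

/-- `B` is a `d` dimensional submanifold of `ℝⁿ` of class `k` (if `α = 0`) or `(k, α)`
(if `α > 0`): near each of its points it is mapped onto a relatively open part of a `d` dimensional
subspace by a diffeomorphism of that class between open sets. -/
def IsSubmanifold {n : ℕ} (k : ℕ) (α : ℝ) (d : ℕ) (B : Set (EuclideanSpace ℝ (Fin n))) : Prop :=
  ∀ b ∈ B, ∃ (e : OpenPartialHomeomorph (EuclideanSpace ℝ (Fin n)) (EuclideanSpace ℝ (Fin n)))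
    (T : Submodule ℝ (EuclideanSpace ℝ (Fin n))),
    b ∈ e.source ∧ IsOfClass k α e e.source ∧ IsOfClass k α e.symm e.target ∧
      Module.finrank ℝ T = d ∧ e '' (B ∩ e.source) = (T : Set (EuclideanSpace ℝ (Fin n))) ∩ e.target

/-- The set `A ⊆ ℝⁿ` is pointwise differentiable at `a` of order `k` (if `α = 0`) or `(k, α)`
(if `α > 0`). The set `A` has to be nonempty because the distance to the empty set is infinite
(`Metric.infDist` would return `0`). -/
def PointwiseDifferentiable {n : ℕ} (k : ℕ) (α : ℝ) (A : Set (EuclideanSpace ℝ (Fin n)))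
    (a : EuclideanSpace ℝ (Fin n)) : Prop :=
  A.Nonempty ∧ ∃ (d : ℕ) (B : Set (EuclideanSpace ℝ (Fin n))),
    IsSubmanifold k α d B ∧ a ∈ B ∧
    Tendsto (fun r : ℝ => r⁻¹ *
        sSup ((fun x => |Metric.infDist x A - Metric.infDist x B|) '' Metric.closedBall a r))
      (𝓝[>] 0) (𝓝 0) ∧
    (α = 0 → Tendsto (fun r : ℝ => (r ^ k)⁻¹ *
        sSup ((fun x => Metric.infDist x B) '' (A ∩ Metric.closedBall a r)))
      (𝓝[>] 0) (𝓝 0)) ∧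
    (0 < α → limsup (fun r : ℝ => ((r ^ (-(k : ℝ) - α) *
        sSup ((fun x => Metric.infDist x B) '' (A ∩ Metric.closedBall a r)) : ℝ) : EReal))
      (𝓝[>] 0) < ⊤)

/-- The projection `(z₁, …, z_{m+1}) ↦ (z₁, …, z_m)`. -/
def projP {m : ℕ} (z : EuclideanSpace ℝ (Fin (m + 1))) : EuclideanSpace ℝ (Fin m) :=
  WithLp.toLp 2 (fun i => z i.castSucc)

/-- The last coordinate `(z₁, …, z_{m+1}) ↦ z_{m+1}`. -/
def projQ {m : ℕ} (z : EuclideanSpace ℝ (Fin (m + 1))) : ℝ :=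
  z (Fin.last m)

/-- The embedding `(x₁, …, x_m) ↦ (x₁, …, x_m, 0)`, adjoint to `projP`. -/
def adjP {m : ℕ} (x : EuclideanSpace ℝ (Fin m)) : EuclideanSpace ℝ (Fin (m + 1)) :=
  WithLp.toLp 2 (Fin.snoc (α := fun _ => ℝ) (fun i => x i) 0)

end PtDiff

/-!
The example depends on one coordinate only: `f x = g (x 0)` and `A = {x | x 0 ∈ S}` with `S ⊆ ℝ`.
The function `g = ∑ j, c j * ψ j (N j * t)` is a sum of `1`-periodic smooth bumps `ψ j` around the
integers, compressed to period `1 / N j`, and `S` is the closed set that remains when a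
neighbourhood of the supports of all the summands is removed. The width of `ψ j` decreases
geometrically, so that `S` meets `[0, 1]` in a set of measure at least `1 / 2`. If `m j` bounds
the derivatives of `ψ j` up to order `k` then `c j = 2⁻ʲ (N j)⁻ᵏ / m j` makes the series converge
in `C^k`, and `g` vanishes to order `k` on `S`. Since `m j` does not depend on `N j`, the frequency
`N j` may be taken so large that `c j / (N j)^(-k - α) → ∞` for every `α > 0`; as each point of `S`
has distance at most `1 / N j` from a peak of height `c j`, the function `g` is not
`O(|t|^(k + α))` at any point of `S` (`exists_isClosed_contDiff_frequently_lt`).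

For the graph `G` of `f` at `c = (a, 0)`, suppose that a submanifold `B` of class `(k, α)` shows
pointwise differentiability. If `B` is a neighbourhood of `c`, then it is not tangent to `G`, by
`eventually_half_le_infDist_graph`. Otherwise `B` lies near `c` in the zero set of a real function
`H` of class `(k, α)` with `DH(c) ≠ 0`. The second condition on `B` gives
`H (y, f y) = O(|y - a|^(k + α))`, whence `DH(c)` is a nonzero multiple of the last coordinate and
`H (y, f y) - H (y, 0)` is comparable to `f y`. Along the first coordinate direction
`h t = H (a + t e, 0)` is therefore `o(t^k)`, so its Taylor polynomial of degree `k` is zero, and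
the Hölder condition on its `k`-th derivative yields `h t = O(|t|^(k + α))`. Hence
`f (a + t e) = O(|t|^(k + α))` (`eventually_abs_le_of_defining_function`), which is false for
every `a ∈ A`.
-/

/-! ### Taylor estimates on the line -/

open Asymptotics in
theorem isLittleO_pow_of_iteratedDeriv_eq_zero {h : ℝ → ℝ} {k : ℕ} (hh : ContDiff ℝ k h) {a : ℝ}
    (h0 : ∀ i ≤ k, iteratedDeriv i h a = 0) :
    (fun t => h (a + t)) =o[𝓝 0] fun t => t ^ k := by
  have key := taylor_isLittleO_univ (x₀ := a) hh
  have hz : ∀ x, taylorWithinEval h k univ a x = 0 := by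
    intro x
    rw [taylor_within_apply]
    refine Finset.sum_eq_zero fun i hi => ?_
    rw [iteratedDerivWithin_univ, h0 i (by simpa [Nat.lt_succ_iff] using hi), smul_zero]
  simp only [hz, sub_zero] at key
  have ht : Tendsto (fun t : ℝ => a + t) (𝓝 0) (𝓝 a) := by
    have : Continuous fun t : ℝ => a + t := by fun_prop
    simpa using this.tendsto 0
  simpa [Function.comp_def] using key.comp_tendsto ht

open Asymptotics in
theorem iteratedDeriv_eq_zero_of_isLittleO_pow {h : ℝ → ℝ} {k : ℕ} {ρ : ℝ} (hρ : 0 < ρ)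
    (hh : ContDiffOn ℝ k h (Metric.ball 0 ρ)) (ho : h =o[𝓝 0] fun t => t ^ k) :
    ∀ i ≤ k, iteratedDeriv i h 0 = 0 := by
  intro i
  induction i using Nat.strong_induction_on with
  | _ i ih =>
  intro hik
  have h0 : (0 : ℝ) ∈ Metric.ball (0 : ℝ) ρ := Metric.mem_ball_self hρ
  have hball : 𝓝[Metric.ball (0 : ℝ) ρ] 0 = 𝓝 0 :=
    Metric.isOpen_ball.nhdsWithin_eq h0
  have key := taylor_isLittleO (convex_ball (0 : ℝ) ρ) h0
    (hh.of_le (by exact_mod_cast hik : ((i : ℕ) : WithTop ℕ∞) ≤ k))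
  have hz : ∀ x, taylorWithinEval h i (Metric.ball 0 ρ) 0 x
      = (((i.factorial : ℝ))⁻¹ * iteratedDeriv i h 0) * x ^ i := by
    intro x
    rw [taylor_within_apply, Finset.sum_range_succ, Finset.sum_eq_zero, zero_add,
      iteratedDerivWithin_of_isOpen Metric.isOpen_ball h0]
    · simp; ring
    · intro j hj
      have hj' := Finset.mem_range.1 hj
      rw [iteratedDerivWithin_of_isOpen Metric.isOpen_ball h0, ih j hj' (by omega), smul_zero]
  simp only [hz, sub_zero, hball] at key
  have ho' : h =o[𝓝 0] fun t => t ^ i := by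
    refine ho.trans_isBigO (IsBigO.of_bound 1 ?_)
    filter_upwards [Metric.ball_mem_nhds (0 : ℝ) one_pos] with t ht
    rw [mem_ball_zero_iff] at ht
    rw [norm_pow, norm_pow, one_mul]
    exact pow_le_pow_of_le_one (norm_nonneg _) ht.le hik
  have hd := ho'.sub key
  simp only [sub_sub_cancel] at hd
  by_contra hne
  have hc : ((i.factorial : ℝ))⁻¹ * iteratedDeriv i h 0 ≠ 0 :=
    mul_ne_zero (inv_ne_zero (by positivity)) hne
  rw [isLittleO_const_mul_left_iff hc] at hd
  have hd' : (fun t : ℝ => t ^ i) =o[𝓝[≠] 0] fun t => t ^ i := hd.mono nhdsWithin_le_nhds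
  refine isLittleO_irrefl (l := 𝓝[≠] (0 : ℝ)) ?_ hd'
  refine Eventually.frequently ?_
  filter_upwards [self_mem_nhdsWithin] with t ht
  exact pow_ne_zero _ ht

/-- A form of Lagrange's remainder on both sides of the base point. -/
theorem exists_abs_le_abs_iteratedDeriv_mul_pow {k : ℕ} {ρ : ℝ} :
    ∀ {h : ℝ → ℝ}, ContDiffOn ℝ k h (Metric.ball 0 ρ) →
    (∀ i < k, iteratedDeriv i h 0 = 0) → ∀ t ∈ Metric.ball (0 : ℝ) ρ,
    ∃ ξ, |ξ| ≤ |t| ∧ |h t| ≤ |iteratedDeriv k h ξ| * |t| ^ k := by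
  induction k with
  | zero => intro h _ _ t _; exact ⟨t, le_rfl, by simp⟩
  | succ k ih =>
    intro h hh h0 t ht
    have hh' := (contDiffOn_succ_iff_deriv_of_isOpen (n := k) Metric.isOpen_ball).1
      (by exact_mod_cast hh)
    have hmv : ∃ η, |η| ≤ |t| ∧ h t = deriv h η * t := by
      have hh0 : h 0 = 0 := by simpa using h0 0 (Nat.succ_pos _)
      have hd : ∀ x, |x| ≤ |t| → DifferentiableAt ℝ h x := fun x hx => by
        have hx' : x ∈ Metric.ball (0 : ℝ) ρ := by
          rw [mem_ball_zero_iff] at ht ⊢; exact lt_of_le_of_lt hx ht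
        exact (hh'.1 x hx').differentiableAt (Metric.isOpen_ball.mem_nhds hx')
      rcases lt_trichotomy t 0 with h1 | h1 | h1
      · obtain ⟨η, hη, he⟩ := exists_deriv_eq_slope h h1
          (fun x hx => (hd x (by
            rw [abs_of_neg h1, abs_of_nonpos hx.2]; linarith [hx.1])).continuousAt.continuousWithinAt)
          (fun x hx => (hd x (by
            rw [abs_of_neg h1, abs_of_neg hx.2]; linarith [hx.1])).differentiableWithinAt)
        refine ⟨η, by rw [abs_of_neg h1, abs_of_neg hη.2]; linarith [hη.1], ?_⟩
        rw [he, hh0]; field_simp; ring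
      · exact ⟨0, by simp, by simp [h1, hh0]⟩
      · obtain ⟨η, hη, he⟩ := exists_deriv_eq_slope h h1
          (fun x hx => (hd x (by
            rw [abs_of_pos h1, abs_of_nonneg hx.1]; linarith [hx.2])).continuousAt.continuousWithinAt)
          (fun x hx => (hd x (by
            rw [abs_of_pos h1, abs_of_pos hx.1]; linarith [hx.2])).differentiableWithinAt)
        refine ⟨η, by rw [abs_of_pos h1, abs_of_pos hη.1]; linarith [hη.2], ?_⟩
        rw [he, hh0]; field_simp; ring
    obtain ⟨η, hη, he⟩ := hmv
    obtain ⟨ξ, hξ, hle⟩ := ih hh'.2.2 (fun i hi => by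
      rw [← iteratedDeriv_succ']; exact h0 (i + 1) (by omega)) η (by
        rw [mem_ball_zero_iff] at ht ⊢; exact lt_of_le_of_lt hη ht)
    refine ⟨ξ, hξ.trans hη, ?_⟩
    rw [he, abs_mul, iteratedDeriv_succ', pow_succ, ← mul_assoc]
    refine mul_le_mul_of_nonneg_right (hle.trans ?_) (abs_nonneg _)
    gcongr

/-- A function of class `C^k` that is `o(t^k)` at the origin and whose `k`-th derivative satisfies
a Hölder condition there is `O(|t|^(k + α))`: its Taylor polynomial of degree `k` vanishes. -/
theorem abs_le_mul_rpow_of_isLittleO_pow {h : ℝ → ℝ} {k : ℕ} {ρ C α : ℝ} (hα : 0 < α)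
    (hh : ContDiffOn ℝ k h (Metric.ball 0 ρ)) (ho : h =o[𝓝 0] fun t => t ^ k)
    (hC : ∀ t ∈ Metric.ball (0 : ℝ) ρ, |iteratedDeriv k h t - iteratedDeriv k h 0| ≤ C * |t| ^ α)
    {t : ℝ} (ht : t ∈ Metric.ball (0 : ℝ) ρ) (ht0 : t ≠ 0) :
    |h t| ≤ |C| * |t| ^ ((k : ℝ) + α) := by
  have hρ : 0 < ρ := Metric.pos_of_mem_ball ht
  have h0 := iteratedDeriv_eq_zero_of_isLittleO_pow hρ hh ho
  obtain ⟨ξ, hξ, hle⟩ := exists_abs_le_abs_iteratedDeriv_mul_pow hh (fun i hi => h0 i hi.le) t ht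
  have h1 := hC ξ (by rw [mem_ball_zero_iff] at ht ⊢; exact lt_of_le_of_lt hξ ht)
  rw [h0 k le_rfl, sub_zero] at h1
  have h2 : |iteratedDeriv k h ξ| ≤ |C| * |t| ^ α :=
    h1.trans (mul_le_mul (le_abs_self C) (Real.rpow_le_rpow (abs_nonneg _) hξ hα.le)
      (by positivity) (abs_nonneg _))
  rw [add_comm, Real.rpow_add (abs_pos.2 ht0), Real.rpow_natCast, ← mul_assoc]
  exact hle.trans (by gcongr)

/-! ### The one dimensional example -/

/-- A smooth `1`-periodic function with values in `[0, 1]` that equals `1` at the integers and,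
for `s > 0`, vanishes wherever `1 - cos (2 π t) ≥ s / 2`. -/
noncomputable def periodicBump (s t : ℝ) : ℝ :=
  Real.smoothTransition (1 - 2 * (1 - Real.cos (2 * Real.pi * t)) / s)

theorem periodicBump_nonneg (s t : ℝ) : 0 ≤ periodicBump s t := Real.smoothTransition.nonneg _

theorem periodicBump_intCast (s : ℝ) (z : ℤ) : periodicBump s z = 1 := by
  have : Real.cos (2 * Real.pi * z) = 1 := by
    rw [mul_comm]; exact Real.cos_int_mul_two_pi z
  simp [periodicBump, this]

theorem periodicBump_eq_zero {s t : ℝ} (hs : 0 < s) (h : s / 2 ≤ 1 - Real.cos (2 * Real.pi * t)) :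
    periodicBump s t = 0 := by
  refine Real.smoothTransition.zero_of_nonpos ?_
  rw [sub_nonpos, le_div_iff₀ hs]
  linarith

theorem contDiff_periodicBump (s : ℝ) (k : ℕ∞) : ContDiff ℝ k (periodicBump s) := by
  unfold periodicBump
  refine Real.smoothTransition.contDiff.comp ?_
  fun_prop

theorem periodic_periodicBump (s : ℝ) : Function.Periodic (periodicBump s) 1 := by
  intro t
  unfold periodicBump
  rw [mul_add, mul_one, Real.cos_add_two_pi]

theorem exists_bound_iteratedDeriv_periodicBump (k : ℕ) (s : ℝ) :
    ∃ M : ℕ, 1 ≤ M ∧ ∀ i ≤ k, ∀ t, ‖iteratedDeriv i (periodicBump s) t‖ ≤ M := by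
  have h1 : ∀ i : ℕ, ∃ C : ℝ, ∀ t, ‖iteratedDeriv i (periodicBump s) t‖ ≤ C := by
    intro i
    have hper : Function.Periodic (iteratedDeriv i (periodicBump s)) 1 := by
      intro t
      have := congrFun (iteratedDeriv_comp_add_const i (periodicBump s) 1) t
      rw [← this, show (fun z => periodicBump s (z + 1)) = periodicBump s from
        funext (periodic_periodicBump s)]
    have hcont : Continuous (iteratedDeriv i (periodicBump s)) :=
      (contDiff_periodicBump s i).continuous_iteratedDeriv i le_rfl
    obtain ⟨C, hC⟩ := isBounded_iff_forall_norm_le.1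
      (hper.isBounded_of_continuous one_ne_zero hcont)
    exact ⟨C, fun t => hC _ (mem_range_self t)⟩
  choose C hC using h1
  refine ⟨⌈∑ i ∈ Finset.range (k + 1), |C i|⌉₊ + 1, by omega, fun i hi t => (hC i t).trans ?_⟩
  have h2 : |C i| ≤ ∑ i ∈ Finset.range (k + 1), |C i| :=
    Finset.single_le_sum (f := fun i => |C i|) (fun _ _ => abs_nonneg _)
      (Finset.mem_range.2 (by omega))
  have h3 := Nat.le_ceil (∑ i ∈ Finset.range (k + 1), |C i|)
  push_cast
  linarith [le_abs_self (C i)]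

theorem eight_mul_sq_sub_round_le (t : ℝ) :
    8 * (t - round t) ^ 2 ≤ 1 - Real.cos (2 * Real.pi * t) := by
  have h1 : Real.cos (2 * Real.pi * t) = Real.cos (2 * Real.pi * (t - round t)) := by
    rw [mul_sub, mul_comm (2 * Real.pi) (round t : ℝ), Real.cos_sub_int_mul_two_pi]
  have h2 : |2 * Real.pi * (t - round t)| ≤ Real.pi := by
    rw [abs_mul, abs_of_pos (by positivity)]
    nlinarith [abs_sub_round t, Real.pi_pos]
  have h3 := Real.cos_le_one_sub_mul_cos_sq h2
  rw [h1]
  have h4 : 2 / Real.pi ^ 2 * (2 * Real.pi * (t - round t)) ^ 2 = 8 * (t - round t) ^ 2 := by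
    field_simp; ring
  linarith

theorem volume_one_sub_cos_lt_le {N : ℕ} (hN : 1 ≤ N) {δ : ℝ} (hδ : 0 < δ) :
    volume {t ∈ Icc (0 : ℝ) 1 | 1 - Real.cos (2 * Real.pi * (N * t)) < 8 * δ ^ 2}
      ≤ ENNReal.ofReal (4 * δ) := by
  have hN' : (1 : ℝ) ≤ N := by exact_mod_cast hN
  have hN0 : (0 : ℝ) < N := by linarith
  have hsub : {t ∈ Icc (0 : ℝ) 1 | 1 - Real.cos (2 * Real.pi * (N * t)) < 8 * δ ^ 2}
      ⊆ ⋃ z ∈ Finset.range (N + 1), Metric.ball ((z : ℝ) / N) (δ / N) := by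
    rintro t ⟨ht, htc⟩
    have h1 := eight_mul_sq_sub_round_le (N * t)
    have h2 : |N * t - round (N * t)| < δ := abs_lt_of_sq_lt_sq (by linarith) hδ.le
    have h3 := abs_le.1 (abs_sub_round (N * t))
    have hz0 : 0 ≤ round (N * t) := by
      have : (-1 : ℝ) < round (N * t) := by nlinarith [ht.1]
      have : (-1 : ℤ) < round (N * t) := by exact_mod_cast this
      omega
    have hzN : round (N * t) ≤ N := by
      have : (round (N * t) : ℝ) < N + 1 := by nlinarith [ht.2]
      have : round (N * t) < (N : ℤ) + 1 := by exact_mod_cast this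
      omega
    obtain ⟨z, hz⟩ := Int.eq_ofNat_of_zero_le hz0
    rw [hz] at h2 hzN
    simp only [mem_iUnion, Finset.mem_range, Metric.mem_ball, Real.dist_eq]
    refine ⟨z, by omega, ?_⟩
    have h4 : t - z / N = (N * t - z) / N := by field_simp
    rw [h4, abs_div, abs_of_pos hN0]
    exact div_lt_div_of_pos_right (by exact_mod_cast h2) hN0
  refine (measure_mono hsub).trans ((measure_biUnion_finset_le _ _).trans ?_)
  simp only [Real.volume_ball, Finset.sum_const, Finset.card_range, nsmul_eq_mul]
  rw [← ENNReal.ofReal_natCast, ← ENNReal.ofReal_mul (by positivity)]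
  refine ENNReal.ofReal_le_ofReal ?_
  push_cast
  rw [← mul_div_assoc, ← mul_div_assoc, div_le_iff₀ hN0]
  nlinarith

/-- The one dimensional example: a closed set of positive measure and a nonnegative function of
class `C^k` that vanishes to order `k` on the set, but is not `O(|t|^(k + α))` for any `α > 0` at
any of its points. -/
theorem exists_isClosed_contDiff_frequently_lt (k : ℕ) :
    ∃ (S : Set ℝ) (g : ℝ → ℝ), IsClosed S ∧ 0 < volume S ∧ (∀ t, 0 ≤ g t) ∧ ContDiff ℝ k g ∧
      (∀ a ∈ S, ∀ i ≤ k, iteratedDeriv i g a = 0) ∧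
      ∀ a ∈ S, ∀ α : ℝ, 0 < α → ∀ C : ℝ,
        ∃ᶠ t in 𝓝[≠] 0, C * |t| ^ ((k : ℝ) + α) < g (a + t) := by
  choose M hM1 hM using fun s => exists_bound_iteratedDeriv_periodicBump k s
  let δ : ℕ → ℝ := fun j => (1 / 8) * (1 / 2) ^ (j + 1)
  let s : ℕ → ℝ := fun j => 8 * δ j ^ 2
  -- The bound `m j` does not involve `N j`, so the frequency `N j` may be chosen so large that
  -- `N j ^ α` eventually beats `m j` and any geometric factor, whatever `α > 0` is.
  let m : ℕ → ℕ := fun j => M (s j)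
  let N : ℕ → ℕ := fun j => (4 ^ j * m j) ^ j
  let c : ℕ → ℝ := fun j => (1 / 2) ^ j * ((N j : ℝ) ^ k)⁻¹ * (m j : ℝ)⁻¹
  let F : ℕ → ℝ → ℝ := fun j t => c j * periodicBump (s j) (N j * t)
  have hδ : ∀ j, 0 < δ j := fun j => by positivity
  have hs : ∀ j, 0 < s j := fun j => by have := hδ j; positivity
  have hm : ∀ j, 1 ≤ m j := fun j => hM1 _
  have hm' : ∀ j, (1 : ℝ) ≤ m j := fun j => by exact_mod_cast hm j
  have h4m : ∀ j, (1 : ℝ) ≤ 4 ^ j * m j := fun j =>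
    one_le_mul_of_one_le_of_one_le (one_le_pow₀ (by norm_num)) (hm' j)
  have hNr : ∀ j, (N j : ℝ) = (4 ^ j * m j : ℝ) ^ j := fun j => by simp [N]
  have hN' : ∀ j, (1 : ℝ) ≤ N j := fun j => by rw [hNr]; exact one_le_pow₀ (h4m j)
  have hN : ∀ j, 1 ≤ N j := fun j => by exact_mod_cast hN' j
  have hc : ∀ j, 0 < c j := fun j => by
    have := hN' j; have := hm' j
    positivity
  have hF : ∀ j (n : ℕ∞), ContDiff ℝ n (F j) := fun j n =>
    contDiff_const.mul ((contDiff_periodicBump _ _).comp (contDiff_const.mul contDiff_id))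
  have hFnn : ∀ j t, 0 ≤ F j t := fun j t => mul_nonneg (hc j).le (periodicBump_nonneg _ _)
  have hFbd : ∀ (i j : ℕ) (t : ℝ), (i : ℕ∞) ≤ (k : ℕ∞) →
      ‖iteratedFDeriv ℝ i (F j) t‖ ≤ (1 / 2) ^ j := by
    intro i j t hi
    have hi' : i ≤ k := by exact_mod_cast hi
    rw [norm_iteratedFDeriv_eq_norm_iteratedDeriv, iteratedDeriv_const_mul_field,
      congrFun (iteratedDeriv_comp_const_mul (contDiff_periodicBump (s j) i) (N j : ℝ)) t,
      norm_mul, Real.norm_of_nonneg (hc j).le, norm_mul, norm_pow, Real.norm_of_nonneg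
      (by positivity : (0 : ℝ) ≤ N j)]
    have hNp := hN' j
    have hmp := hm' j
    calc c j * ((N j : ℝ) ^ i * ‖iteratedDeriv i (periodicBump (s j)) (N j * t)‖)
        ≤ c j * ((N j : ℝ) ^ k * m j) := by
          have := (hc j).le
          have := hM (s j) i hi' (N j * t)
          gcongr
      _ = (1 / 2) ^ j := by
          have h1 : (N j : ℝ) ≠ 0 := by positivity
          have h2 : (m j : ℝ) ≠ 0 := by positivity
          simp only [c]
          field_simp
  have hgeom : Summable fun j : ℕ => (1 / 2 : ℝ) ^ j := summable_geometric_two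
  have hsum : ∀ t, Summable fun j => F j t := fun t =>
    Summable.of_norm_bounded hgeom fun j => by
      simpa using hFbd 0 j t (by simp)
  let S : Set ℝ := {t | ∀ j, s j ≤ 1 - Real.cos (2 * Real.pi * (N j * t))}
  refine ⟨S, fun t => ∑' j, F j t, ?_, ?_, fun t => tsum_nonneg fun j => hFnn j t, ?_, ?_, ?_⟩
  · simp only [S, ofPred_forall]
    exact isClosed_iInter fun j => isClosed_le continuous_const (by fun_prop)
  · let V : ℕ → Set ℝ := fun j =>
      {t ∈ Icc (0 : ℝ) 1 | 1 - Real.cos (2 * Real.pi * (N j * t)) < 8 * δ j ^ 2}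
    have hcov : Icc (0 : ℝ) 1 ⊆ S ∪ ⋃ j, V j := by
      intro t ht
      by_cases hS : t ∈ S
      · exact Or.inl hS
      · simp only [S, mem_ofPred_eq, not_forall, not_le] at hS
        obtain ⟨j, hj⟩ := hS
        exact Or.inr (mem_iUnion.2 ⟨j, ht, hj⟩)
    have hV : volume (⋃ j, V j) ≤ ENNReal.ofReal (1 / 2) := by
      refine (measure_iUnion_le _).trans ?_
      have h1 : ∀ j, volume (V j) ≤ ENNReal.ofReal (1 / 4 * (1 / 2) ^ j) := fun j =>
        (volume_one_sub_cos_lt_le (hN j) (hδ j)).trans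
          (ENNReal.ofReal_le_ofReal (by simp only [δ, pow_succ]; linarith))
      refine (ENNReal.tsum_le_tsum h1).trans ?_
      rw [← ENNReal.ofReal_tsum_of_nonneg (fun j => by positivity) (hgeom.mul_left _),
        tsum_mul_left, tsum_geometric_two]
      exact ENNReal.ofReal_le_ofReal (by norm_num)
    rw [pos_iff_ne_zero]
    intro h0
    have h1 := (measure_mono hcov).trans (measure_union_le (μ := volume) _ _)
    rw [h0, zero_add, Real.volume_Icc] at h1
    have h2 := h1.trans hV
    rw [ENNReal.ofReal_le_ofReal_iff (by norm_num)] at h2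
    norm_num at h2
  · exact contDiff_tsum (N := (k : ℕ∞)) (fun j => hF j _) (fun _ _ => hgeom) hFbd
  · intro a ha i hi
    have h1 := iteratedFDeriv_tsum_apply (N := (k : ℕ∞)) (fun j => hF j _) (fun _ _ => hgeom) hFbd
      (k := i) (by exact_mod_cast hi) a
    have h2 : ∀ j, iteratedFDeriv ℝ i (F j) a = 0 := by
      intro j
      have hev : F j =ᶠ[𝓝 a] fun _ => 0 := by
        have hop : IsOpen {t : ℝ | s j / 2 < 1 - Real.cos (2 * Real.pi * (N j * t))} :=
          isOpen_lt continuous_const (by fun_prop)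
        have hmem : a ∈ {t : ℝ | s j / 2 < 1 - Real.cos (2 * Real.pi * (N j * t))} := by
          have := ha j
          have := hs j
          simp only [mem_ofPred_eq]
          linarith
        filter_upwards [hop.mem_nhds hmem] with t ht
        simp only [F, periodicBump_eq_zero (hs j) (le_of_lt ht), mul_zero]
      rw [(hev.iteratedFDeriv ℝ i).eq_of_nhds]
      exact congrFun (iteratedFDeriv_fun_zero (𝕜 := ℝ) (n := i)) a
    rw [iteratedDeriv_eq_iteratedFDeriv, h1]
    simp [h2]
  · intro a ha α hα C
    let t : ℕ → ℝ := fun j => (round (N j * a) : ℝ) / N j - a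
    have hat : ∀ j, N j * (a + t j) = (round (N j * a) : ℤ) := fun j => by
      have := hN' j
      have h1 : (N j : ℝ) ≠ 0 := by positivity
      simp only [t]; field_simp; ring
    have htle : ∀ j, |t j| ≤ (N j : ℝ)⁻¹ := fun j => by
      have hNj := hN' j
      have h1 : (N j : ℝ) ≠ 0 := by positivity
      have h2 : t j = -((N j * a - round (N j * a)) / N j) := by simp only [t]; field_simp; ring
      rw [h2, abs_neg, abs_div, abs_of_pos (by positivity : (0 : ℝ) < N j), div_eq_mul_inv]
      have h3 := abs_sub_round (N j * a)
      have h4 : (0 : ℝ) ≤ (N j : ℝ)⁻¹ := by positivity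
      nlinarith
    have htne : ∀ j, t j ≠ 0 := fun j h0 => by
      have h1 := ha j
      have h2 := hat j
      rw [h0, add_zero] at h2
      rw [h2, mul_comm, Real.cos_int_mul_two_pi] at h1
      linarith [hs j]
    have hNlarge : ∀ j, 1 ≤ j → (2 : ℝ) ^ j ≤ N j := fun j hj => by
      rw [hNr]
      calc (2 : ℝ) ^ j ≤ 4 ^ j := by gcongr; norm_num
        _ ≤ 4 ^ j * m j := le_mul_of_one_le_right (by positivity) (hm' j)
        _ ≤ (4 ^ j * m j : ℝ) ^ j := le_self_pow₀ (h4m j) (by omega)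
    have htlim : Tendsto t atTop (𝓝[≠] 0) := by
      refine tendsto_nhdsWithin_iff.2 ⟨?_, Eventually.of_forall htne⟩
      refine squeeze_zero_norm' ?_ (tendsto_pow_atTop_nhds_zero_of_lt_one
        (r := (1 / 2 : ℝ)) (by norm_num) (by norm_num))
      filter_upwards [eventually_ge_atTop 1] with j hj
      refine (htle j).trans ?_
      rw [one_div, inv_pow]
      exact inv_anti₀ (by positivity) (hNlarge j hj)
    refine htlim.frequently (Eventually.frequently ?_)
    have hlim : ∀ᶠ j : ℕ in atTop, |C| * (1 / 2 : ℝ) ^ j < 1 := by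
      have := (tendsto_pow_atTop_nhds_zero_of_lt_one
        (r := (1 / 2 : ℝ)) (by norm_num) (by norm_num)).const_mul |C|
      rw [mul_zero] at this
      exact this.eventually (gt_mem_nhds one_pos)
    filter_upwards [hlim, eventually_ge_atTop ⌈α⁻¹⌉₊] with j hj hjα
    have hNj := hN' j
    have hmj := hm' j
    have hNpos : (0 : ℝ) < N j := by linarith
    have hmpos : (0 : ℝ) < m j := by linarith
    have hNα : (4 : ℝ) ^ j * m j ≤ (N j : ℝ) ^ α := by
      have h1 : 1 ≤ (j : ℝ) * α := by
        have := (Nat.le_ceil α⁻¹).trans (by exact_mod_cast hjα : ((⌈α⁻¹⌉₊ : ℕ) : ℝ) ≤ j)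
        rwa [inv_le_iff_one_le_mul₀ hα] at this
      rw [hNr, ← Real.rpow_natCast_mul (by positivity)]
      exact Real.self_le_rpow_of_one_le (h4m j) h1
    calc C * |t j| ^ ((k : ℝ) + α) ≤ |C| * ((N j : ℝ)⁻¹) ^ ((k : ℝ) + α) := by
          have := htle j
          exact mul_le_mul (le_abs_self C) (Real.rpow_le_rpow (abs_nonneg _) this (by positivity))
            (by positivity) (abs_nonneg _)
      _ = |C| * (((N j : ℝ) ^ k)⁻¹ * ((N j : ℝ) ^ α)⁻¹) := by
          rw [Real.inv_rpow hNpos.le, Real.rpow_add hNpos, Real.rpow_natCast, mul_inv]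
      _ ≤ |C| * (((N j : ℝ) ^ k)⁻¹ * ((4 : ℝ) ^ j * m j)⁻¹) := by
          gcongr
      _ = (|C| * (1 / 2 : ℝ) ^ j) * c j := by
          have h4 : (4 : ℝ) ^ j = 2 ^ j * 2 ^ j := by rw [← mul_pow]; norm_num
          simp only [c, h4, one_div, inv_pow, mul_inv]; ring
      _ < 1 * c j := mul_lt_mul_of_pos_right hj (hc j)
      _ = F j (a + t j) := by
          simp only [F]
          rw [hat j, periodicBump_intCast, mul_one, one_mul]
      _ ≤ ∑' i, F i (a + t j) := (hsum _).le_tsum j fun i _ => hFnn i _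

/-! ### Functions that nearly vanish on a graph -/

theorem iteratedDeriv_comp_line {W : Type*} [NormedAddCommGroup W] [NormedSpace ℝ W] {k : ℕ}
    {H : W → ℝ} {U : Set W} (hU : IsOpen U) (hH : ContDiffOn ℝ k H U) (c u : W) {t : ℝ}
    (ht : c + t • u ∈ U) :
    iteratedDeriv k (fun t : ℝ => H (c + t • u)) t
      = iteratedFDeriv ℝ k H (c + t • u) (fun _ => u) := by
  let g : ℝ →L[ℝ] W := ContinuousLinearMap.smulRight (1 : ℝ →L[ℝ] ℝ) u
  have hg : ∀ t : ℝ, g t = t • u := fun t => by simp [g]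
  have htr : Continuous fun w : W => c + w := by fun_prop
  have hU0 : IsOpen ((fun w => c + w) ⁻¹' U) := hU.preimage htr
  have hH0 : ContDiffOn ℝ k (fun w => H (c + w)) ((fun w => c + w) ⁻¹' U) :=
    hH.comp (by fun_prop) (fun _ h => h)
  have hU1 : IsOpen (g ⁻¹' ((fun w => c + w) ⁻¹' U)) := hU0.preimage g.continuous
  have htU : g t ∈ (fun w => c + w) ⁻¹' U := by simpa [hg] using ht
  have h := g.iteratedFDerivWithin_comp_right hH0 hU0.uniqueDiffOn hU1.uniqueDiffOn htU
    (i := k) le_rfl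
  rw [iteratedFDerivWithin_of_isOpen k hU1 htU, iteratedFDerivWithin_of_isOpen k hU0 htU,
    iteratedFDeriv_comp_add_left, hg] at h
  have hfun : (fun w => H (c + w)) ∘ g = fun t : ℝ => H (c + t • u) := by
    funext t; simp [hg]
  rw [hfun] at h
  rw [iteratedDeriv_eq_iteratedFDeriv, h]
  simp [hg]

open Asymptotics in
/-- The analytic core. Let `H` be a function of class `(k, α)` with nonzero derivative at `J a`,
whose values on the graph of `f` are small of order `k + α`. If `f` is differentiable at `a` with
derivative zero then `H` is, to first order, a nonzero multiple of the height above the base, so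
that `f` is comparable to `H` restricted to the base, up to an error of order `k + α`. That
restriction is small of order `o(t^k)` along a line on which `f` is, hence of order `k + α`
there, and so is `f`. -/
theorem eventually_abs_le_of_defining_function {E W : Type*} [NormedAddCommGroup E]
    [NormedSpace ℝ E] [NormedAddCommGroup W] [NormedSpace ℝ W] [CompleteSpace W]
    {k : ℕ} (hk : 0 < k) {α : ℝ} (hα : 0 < α)
    {J : E →L[ℝ] W} {e : W} (hJe : ∀ w, ∃ x, ∃ s : ℝ, w = J x + s • e)
    {f : E → ℝ} {a v : E} (hfa : f a = 0) (hf : HasFDerivAt f (0 : E →L[ℝ] ℝ) a)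
    (hfv : (fun t : ℝ => f (a + t • v)) =o[𝓝 0] fun t => t ^ k)
    {H : W → ℝ} {U : Set W} (hU : IsOpen U) (haU : J a ∈ U) (hH : ContDiffOn ℝ k H U)
    {C : ℝ} (hC : ∀ᶠ w in 𝓝 (J a),
      ‖iteratedFDeriv ℝ k H w - iteratedFDeriv ℝ k H (J a)‖ ≤ C * ‖w - J a‖ ^ α)
    (hD : fderiv ℝ H (J a) ≠ 0)
    {C' : ℝ} (hC' : ∀ᶠ y in 𝓝 a,
      |H (J y + f y • e)| ≤ C' * ‖J y + f y • e - J a‖ ^ ((k : ℝ) + α)) :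
    ∃ K : ℝ, ∀ᶠ t in 𝓝[≠] (0 : ℝ), |f (a + t • v)| ≤ K * |t| ^ ((k : ℝ) + α) := by
  have hk1 : (1 : ℝ) ≤ k := by exact_mod_cast hk
  have hkα : (1 : ℝ) < (k : ℝ) + α := by linarith
  have hHs : HasStrictFDerivAt H (fderiv ℝ H (J a)) (J a) :=
    (hH.contDiffAt (hU.mem_nhds haU)).hasStrictFDerivAt (by exact_mod_cast hk.ne')
  set D := fderiv ℝ H (J a) with hDdef
  let Φ : E → W := fun y => J y + f y • e
  have hΦa : Φ a = J a := by simp [Φ, hfa]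
  have hΦ : HasFDerivAt Φ J a := by
    have h1 := (J.hasFDerivAt (x := a)).add (hf.smul_const e)
    convert! h1 using 1
    ext; simp
  have hΦO : (fun y => Φ y - J a) =O[𝓝 a] fun y => y - a := by
    simpa [hΦa] using hΦ.isBigO_sub
  obtain ⟨L, hLpos, hL⟩ := hΦO.exists_pos
  rw [isBigOWith_iff] at hL
  have hHΦ : ∀ᶠ y in 𝓝 a, |H (Φ y)| ≤ (|C'| * L ^ ((k : ℝ) + α)) * ‖y - a‖ ^ ((k : ℝ) + α) := by
    filter_upwards [hC', hL] with y h1 h2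
    rw [mul_assoc, ← Real.mul_rpow hLpos.le (norm_nonneg _)]
    exact h1.trans (mul_le_mul (le_abs_self _)
      (Real.rpow_le_rpow (norm_nonneg _) h2 (by linarith)) (by positivity) (abs_nonneg _))
  set C₁ := |C'| * L ^ ((k : ℝ) + α) with hC₁
  have hC₁0 : 0 ≤ C₁ := by positivity
  -- The derivative of `H` along the base vanishes.
  have hDJ : ∀ x, D (J x) = 0 := by
    have h1 : HasFDerivAt (H ∘ Φ) (D.comp J) a := by
      refine HasFDerivAt.comp a ?_ hΦ
      rw [hΦa]; exact hHs.hasFDerivAt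
    have h2 : HasFDerivAt (H ∘ Φ) (0 : E →L[ℝ] ℝ) a := by
      have h0 : (H ∘ Φ) a = 0 := by
        have := hHΦ.self_of_nhds
        rw [sub_self, norm_zero, Real.zero_rpow (by linarith), mul_zero] at this
        simpa using le_antisymm this (abs_nonneg _)
      rw [hasFDerivAt_iff_isLittleO, h0]
      simp only [zero_apply, sub_zero]
      rw [isLittleO_iff]
      intro ε hε
      have hlim : Tendsto (fun y : E => C₁ * ‖y - a‖ ^ ((k : ℝ) + α - 1)) (𝓝 a) (𝓝 0) := by
        have hcont : Continuous fun y : E => C₁ * ‖y - a‖ ^ ((k : ℝ) + α - 1) := by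
          refine continuous_const.mul ?_
          exact (by fun_prop : Continuous fun y : E => ‖y - a‖).rpow_const
            (fun _ => Or.inr (by linarith))
        have := hcont.tendsto a
        rwa [sub_self, norm_zero, Real.zero_rpow (by linarith), mul_zero] at this
      filter_upwards [hHΦ, hlim.eventually (gt_mem_nhds hε)] with y h3 h4
      rw [Real.norm_eq_abs]
      refine h3.trans ?_
      rcases eq_or_ne y a with rfl | hy
      · simp [Real.zero_rpow (by linarith : (k : ℝ) + α ≠ 0)]
      · have hpos : 0 < ‖y - a‖ := norm_pos_iff.2 (sub_ne_zero.2 hy)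
        have h5 : ‖y - a‖ ^ ((k : ℝ) + α) = ‖y - a‖ ^ ((k : ℝ) + α - 1) * ‖y - a‖ := by
          rw [← Real.rpow_add_one hpos.ne']; ring_nf
        rw [h5, ← mul_assoc]
        gcongr
    have h3 := h1.unique h2
    intro x
    simpa using congrArg (fun T : E →L[ℝ] ℝ => T x) h3
  have hlam : D e ≠ 0 := by
    intro h0
    apply hD
    ext w
    obtain ⟨x, s, rfl⟩ := hJe w
    simp [hDJ, h0]
  set lam := |D e| with hlamdef
  have hlampos : 0 < lam := abs_pos.2 hlam
  have hline : Tendsto (fun t : ℝ => a + t • v) (𝓝 0) (𝓝 a) := by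
    have : Continuous fun t : ℝ => a + t • v := by fun_prop
    simpa using this.tendsto 0
  have hline' : Tendsto (fun t : ℝ => J a + t • J v) (𝓝 0) (𝓝 (J a)) := by
    have : Continuous fun t : ℝ => J a + t • J v := by fun_prop
    simpa using this.tendsto 0
  let h : ℝ → ℝ := fun t => H (J a + t • J v)
  have hcomp : ∀ᶠ t in 𝓝 (0 : ℝ),
      |H (Φ (a + t • v)) - h t - f (a + t • v) * D e| ≤ lam / 2 * |f (a + t • v)| := by
    have h1 : Tendsto (fun t : ℝ => (Φ (a + t • v), J a + t • J v)) (𝓝 0) (𝓝 (J a, J a)) := by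
      refine Tendsto.prodMk_nhds ?_ hline'
      have := hΦ.continuousAt.tendsto
      rw [hΦa] at this
      exact this.comp hline
    have h2 := (isLittleO_iff.1 hHs.isLittleO) (c := lam / (2 * (‖e‖ + 1))) (by positivity)
    filter_upwards [h1.eventually h2] with t ht
    have h3 : Φ (a + t • v) - (J a + t • J v) = f (a + t • v) • e := by
      simp [Φ]
    simp only [h3, map_smul, smul_eq_mul, norm_smul, Real.norm_eq_abs] at ht
    refine ht.trans ?_
    rw [div_mul_eq_mul_div, div_le_iff₀ (by positivity)]
    nlinarith [mul_nonneg hlampos.le (abs_nonneg (f (a + t • v))), norm_nonneg e]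
  have hHt : ∀ᶠ t in 𝓝 (0 : ℝ),
      |H (Φ (a + t • v))| ≤ (C₁ * ‖v‖ ^ ((k : ℝ) + α)) * |t| ^ ((k : ℝ) + α) := by
    filter_upwards [hline.eventually hHΦ] with t ht
    rw [add_sub_cancel_left, norm_smul, Real.norm_eq_abs, mul_comm |t|,
      Real.mul_rpow (norm_nonneg _) (abs_nonneg _), ← mul_assoc] at ht
    exact ht
  set C₂ := C₁ * ‖v‖ ^ ((k : ℝ) + α) with hC₂
  have hC₂0 : 0 ≤ C₂ := by positivity
  have hHo : (fun t : ℝ => H (Φ (a + t • v))) =o[𝓝 0] fun t => t ^ k := by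
    rw [isLittleO_iff]
    intro ε hε
    have hlim : Tendsto (fun t : ℝ => C₂ * |t| ^ α) (𝓝 0) (𝓝 0) := by
      have hcont : Continuous fun t : ℝ => C₂ * |t| ^ α :=
        continuous_const.mul (continuous_abs.rpow_const fun _ => Or.inr hα.le)
      have := hcont.tendsto 0
      rwa [abs_zero, Real.zero_rpow hα.ne', mul_zero] at this
    filter_upwards [hHt, hlim.eventually (gt_mem_nhds hε)] with t h1 h2
    rw [Real.norm_eq_abs, norm_pow, Real.norm_eq_abs]
    refine h1.trans ?_
    rcases eq_or_ne t 0 with rfl | ht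
    · simp [Real.zero_rpow (by linarith : (k : ℝ) + α ≠ 0), hk.ne']
    · rw [add_comm, Real.rpow_add (abs_pos.2 ht), Real.rpow_natCast, ← mul_assoc]
      gcongr
  have hho : h =o[𝓝 0] fun t => t ^ k := by
    refine IsBigO.trans_isLittleO (g := fun t => |H (Φ (a + t • v))| + |f (a + t • v)|) ?_
      (hHo.norm_left.add hfv.norm_left)
    refine IsBigO.of_bound (1 + 2 * lam) ?_
    filter_upwards [hcomp] with t ht
    rw [Real.norm_eq_abs, Real.norm_of_nonneg (by positivity)]
    have h1 := abs_le.1 ht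
    have h2 : |f (a + t • v) * D e| = |f (a + t • v)| * lam := abs_mul _ _
    have h3 := abs_le.1 h2.le
    have h4 := abs_le.1 (le_refl |H (Φ (a + t • v))|)
    have h5 := mul_nonneg hlampos.le (abs_nonneg (f (a + t • v)))
    have h6 := mul_nonneg hlampos.le (abs_nonneg (H (Φ (a + t • v))))
    have h7 := abs_nonneg (f (a + t • v))
    rw [abs_le]
    constructor <;> nlinarith
  obtain ⟨ρ, hρ, hball⟩ := Metric.eventually_nhds_iff_ball.1
    ((hline'.eventually (hU.mem_nhds haU)).and (hline'.eventually hC))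
  have hhC : ContDiffOn ℝ k h (Metric.ball 0 ρ) :=
    hH.comp (t := U) (by fun_prop) (fun t ht => (hball t ht).1)
  have hhH : ∀ t ∈ Metric.ball (0 : ℝ) ρ, |iteratedDeriv k h t - iteratedDeriv k h 0|
      ≤ (C * ‖J v‖ ^ α * ‖J v‖ ^ k) * |t| ^ α := by
    intro t ht
    have h0 := hball 0 (Metric.mem_ball_self hρ)
    rw [iteratedDeriv_comp_line hU hH _ _ (hball t ht).1, iteratedDeriv_comp_line hU hH _ _ h0.1]
    rw [zero_smul, add_zero, ← sub_apply, ← Real.norm_eq_abs]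
    refine (ContinuousMultilinearMap.le_opNorm _ _).trans ?_
    rw [Finset.prod_const, Finset.card_univ, Fintype.card_fin]
    have h1 := (hball t ht).2
    rw [add_sub_cancel_left, norm_smul, Real.norm_eq_abs,
      Real.mul_rpow (abs_nonneg _) (norm_nonneg _)] at h1
    calc _ ≤ C * (|t| ^ α * ‖J v‖ ^ α) * ‖J v‖ ^ k :=
          mul_le_mul_of_nonneg_right h1 (by positivity)
      _ = _ := by ring
  refine ⟨2 * (C₂ + |C * ‖J v‖ ^ α * ‖J v‖ ^ k|) / lam, ?_⟩
  filter_upwards [self_mem_nhdsWithin, nhdsWithin_le_nhds hcomp, nhdsWithin_le_nhds hHt,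
    nhdsWithin_le_nhds (Metric.ball_mem_nhds (0 : ℝ) hρ)] with t ht0 h1 h2 htb
  have h3 := abs_le_mul_rpow_of_isLittleO_pow hα hhC hho hhH htb ht0
  rw [div_mul_eq_mul_div, le_div_iff₀ hlampos]
  have h4 : |f (a + t • v) * D e| = |f (a + t • v)| * lam := abs_mul _ _
  have h5 : |f (a + t • v) * D e| ≤ |H (Φ (a + t • v)) - h t - f (a + t • v) * D e|
      + (|H (Φ (a + t • v))| + |h t|) := by
    have e1 : f (a + t • v) * D e = -(H (Φ (a + t • v)) - h t - f (a + t • v) * D e)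
      + (H (Φ (a + t • v)) - h t) := by ring
    have e2 := abs_add_le (-(H (Φ (a + t • v)) - h t - f (a + t • v) * D e))
      (H (Φ (a + t • v)) - h t)
    rw [← e1, abs_neg] at e2
    exact e2.trans (by gcongr; exact abs_sub _ _)
  nlinarith

/-! ### Defining functions of submanifolds -/

/-- Near each of its points a submanifold of class `(k, α)` is either a full neighbourhood of that
point, or it is contained in the zero set of a real valued function of class `(k, α)` with nonzero
derivative: a coordinate function of a chart in a direction transversal to the model subspace. -/
theorem PtDiff.IsSubmanifold.mem_nhds_or_exists_defining_function {n k d : ℕ} (hk : 0 < k) {α : ℝ}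
    (hα : 0 < α) {B : Set (EuclideanSpace ℝ (Fin n))} (hB : PtDiff.IsSubmanifold k α d B)
    {c : EuclideanSpace ℝ (Fin n)} (hc : c ∈ B) :
    B ∈ 𝓝 c ∨ ∃ (H : EuclideanSpace ℝ (Fin n) → ℝ) (U : Set (EuclideanSpace ℝ (Fin n))),
      IsOpen U ∧ c ∈ U ∧ ContDiffOn ℝ k H U ∧
      (∃ C : ℝ, ∀ᶠ w in 𝓝 c,
        ‖iteratedFDeriv ℝ k H w - iteratedFDeriv ℝ k H c‖ ≤ C * ‖w - c‖ ^ α) ∧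
      fderiv ℝ H c ≠ 0 ∧ ∀ b ∈ B ∩ U, H b = 0 := by
  obtain ⟨e, T, hce, ⟨hopen, hCe, hHe⟩, ⟨-, hCs, -⟩, -, himg⟩ := hB c hc
  by_cases hT : T = ⊤
  · left
    refine mem_of_superset (hopen.mem_nhds hce) fun x hx => ?_
    have hx' : e x ∈ e '' (B ∩ e.source) := by
      rw [himg, hT]; exact ⟨trivial, e.map_source hx⟩
    obtain ⟨y, ⟨hyB, hys⟩, hy⟩ := hx'
    rwa [← e.injOn hys hx hy]
  · right
    obtain ⟨Λ₀, hΛ₀, hΛT⟩ := Submodule.exists_le_ker_of_lt_top T (lt_top_iff_ne_top.2 hT)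
    let Λ : EuclideanSpace ℝ (Fin n) →L[ℝ] ℝ := LinearMap.toContinuousLinearMap Λ₀
    have hk1 : ((k : ℕ) : WithTop ℕ∞) ≠ 0 := by exact_mod_cast hk.ne'
    have hdiff : ∀ w ∈ e.source, iteratedFDeriv ℝ k (Λ ∘ e) w
        = Λ.compContinuousMultilinearMap (iteratedFDeriv ℝ k e w) := fun w hw =>
      Λ.iteratedFDeriv_comp_left (hCe.contDiffAt (hopen.mem_nhds hw)) le_rfl
    refine ⟨Λ ∘ e, e.source, hopen, hce, Λ.contDiff.comp_contDiffOn hCe, ?_, ?_, ?_⟩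
    · obtain ⟨V, hV, C, hC⟩ := hHe hα c hce
      refine ⟨‖Λ‖ * C, ?_⟩
      filter_upwards [hV, hopen.mem_nhds hce] with w hwV hws
      rw [hdiff w hws, hdiff c hce]
      have h1 : Λ.compContinuousMultilinearMap (iteratedFDeriv ℝ k e w)
          - Λ.compContinuousMultilinearMap (iteratedFDeriv ℝ k e c)
          = Λ.compContinuousMultilinearMap (iteratedFDeriv ℝ k e w - iteratedFDeriv ℝ k e c) := by
        ext; simp
      rw [h1, mul_assoc]
      refine (ContinuousLinearMap.norm_compContinuousMultilinearMap_le _ _).trans ?_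
      exact mul_le_mul_of_nonneg_left (hC w ⟨hwV, hws⟩ c ⟨mem_of_mem_nhds hV, hce⟩) (norm_nonneg _)
    · have hde : DifferentiableAt ℝ e c :=
        (hCe.contDiffAt (hopen.mem_nhds hce)).differentiableAt hk1
      have hds : DifferentiableAt ℝ e.symm (e c) :=
        (hCs.contDiffAt (e.open_target.mem_nhds (e.map_source hce))).differentiableAt hk1
      have hinv : (fderiv ℝ e c).comp (fderiv ℝ e.symm (e c)) = ContinuousLinearMap.id ℝ _ := by
        have h1 : HasFDerivAt (e ∘ e.symm) ((fderiv ℝ e c).comp (fderiv ℝ e.symm (e c))) (e c) := by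
          refine HasFDerivAt.comp _ ?_ hds.hasFDerivAt
          rw [e.left_inv hce]; exact hde.hasFDerivAt
        have h2 : HasFDerivAt (e ∘ e.symm) (ContinuousLinearMap.id ℝ _) (e c) := by
          refine (hasFDerivAt_id (e c)).congr_of_eventuallyEq ?_
          filter_upwards [e.open_target.mem_nhds (e.map_source hce)] with y hy
          exact e.right_inv hy
        exact h1.unique h2
      intro h0
      apply hΛ₀
      ext u
      have h1 : fderiv ℝ (Λ ∘ e) c = Λ.comp (fderiv ℝ e c) :=
        (Λ.hasFDerivAt.comp c hde.hasFDerivAt).fderiv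
      have h2 := congrArg (fun A => A (fderiv ℝ e.symm (e c) u)) (h1.symm.trans h0)
      have h3 := congrArg (fun A => A u) hinv
      simp only [ContinuousLinearMap.comp_apply, ContinuousLinearMap.id_apply] at h2 h3
      rw [h3] at h2
      simpa [Λ] using h2
    · rintro b ⟨hbB, hbs⟩
      have h1 : e b ∈ (T : Set (EuclideanSpace ℝ (Fin n))) ∩ e.target := by
        rw [← himg]; exact mem_image_of_mem _ ⟨hbB, hbs⟩
      exact hΛT h1.1

/-! ### Distances to a set of high order contact -/

theorem bddAbove_infDist_image_inter_closedBall {X : Type*} [PseudoMetricSpace X] {B G : Set X}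
    {c : X} (hc : c ∈ B) (r : ℝ) :
    BddAbove ((fun x => Metric.infDist x B) '' (G ∩ Metric.closedBall c r)) := by
  refine ⟨r, ?_⟩
  rintro _ ⟨x, ⟨-, hx⟩, rfl⟩
  exact (Metric.infDist_le_dist_of_mem hc).trans hx

theorem exists_infDist_le_of_limsup_lt_top {X : Type*} [PseudoMetricSpace X] {B G : Set X}
    {c : X} (hc : c ∈ B) {p : ℝ}
    (h : limsup (fun r : ℝ => ((r ^ (-p) *
        sSup ((fun x => Metric.infDist x B) '' (G ∩ Metric.closedBall c r)) : ℝ) : EReal))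
      (𝓝[>] 0) < ⊤) :
    ∃ M : ℝ, 0 < M ∧ ∀ᶠ x in 𝓝 c, x ∈ G → 0 < dist x c →
      Metric.infDist x B ≤ M * dist x c ^ p := by
  obtain ⟨M, hM⟩ : ∃ M : ℝ, limsup (fun r : ℝ => ((r ^ (-p) *
        sSup ((fun x => Metric.infDist x B) '' (G ∩ Metric.closedBall c r)) : ℝ) : EReal))
      (𝓝[>] 0) < M := by
    obtain ⟨y, hy1, hy2⟩ := EReal.lt_iff_exists_real_btwn.1 h
    exact ⟨y, hy1⟩
  have hev := eventually_lt_of_limsup_lt hM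
  refine ⟨|M| + 1, by positivity, ?_⟩
  rw [eventually_nhdsWithin_iff, Metric.eventually_nhds_iff] at hev
  obtain ⟨ε, hε, hev⟩ := hev
  filter_upwards [Metric.ball_mem_nhds c hε] with x hx hxG hpos
  have h1 := hev (y := dist x c) (by simpa using hx) hpos
  rw [EReal.coe_lt_coe_iff, Real.rpow_neg hpos.le] at h1
  have hpp : 0 < dist x c ^ p := Real.rpow_pos_of_pos hpos p
  rw [inv_mul_lt_iff₀ hpp] at h1
  have h2 : Metric.infDist x B ≤ _ :=
    le_csSup (bddAbove_infDist_image_inter_closedBall (G := G) hc (dist x c))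
      (mem_image_of_mem _ ⟨hxG, Metric.mem_closedBall.2 le_rfl⟩)
  calc _ ≤ _ := h2.trans h1.le
    _ ≤ dist x c ^ p * (|M| + 1) := by
      gcongr; linarith [le_abs_self M]
    _ = _ := mul_comm _ _

/-- A differentiable function that vanishes on `B` is of order `p` on any set whose distance
to `B` is of order `p`. -/
theorem exists_abs_le_of_infDist_le {W : Type*} [NormedAddCommGroup W] [NormedSpace ℝ W]
    {B G : Set W} {c : W} (hc : c ∈ B) {p M : ℝ} (hp : 1 ≤ p) (hM0 : 0 < M)
    (hM : ∀ᶠ x in 𝓝 c, x ∈ G → 0 < dist x c → Metric.infDist x B ≤ M * dist x c ^ p)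
    {H : W → ℝ} {D : W →L[ℝ] ℝ} (hH : HasStrictFDerivAt H D c) {U : Set W} (hU : U ∈ 𝓝 c)
    (hHB : ∀ b ∈ B ∩ U, H b = 0) :
    ∃ C : ℝ, ∀ᶠ x in 𝓝 c, x ∈ G → |H x| ≤ C * ‖x - c‖ ^ p := by
  obtain ⟨L, V, hV, hL⟩ := hH.exists_lipschitzOnWith
  obtain ⟨ε, hε, hball⟩ := Metric.mem_nhds_iff.1 (inter_mem hU hV)
  refine ⟨L * (M + 1), ?_⟩
  have hδ : 0 < min 1 (ε / (M + 2)) := by positivity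
  filter_upwards [hM, Metric.ball_mem_nhds c hδ] with x hx hxb hxG
  rw [← dist_eq_norm]
  rcases dist_nonneg (x := x) (y := c) |>.eq_or_lt with h0 | hpos
  · have hxc : x = c := dist_eq_zero.1 h0.symm
    rw [hxc, hHB c ⟨hc, mem_of_mem_nhds hU⟩, abs_zero]
    positivity
  · have hx1 : dist x c < 1 := lt_of_lt_of_le hxb (min_le_left _ _)
    have hx2 : dist x c * (M + 2) < ε := by
      have := lt_of_lt_of_le (Metric.mem_ball.1 hxb) (min_le_right _ _)
      rwa [lt_div_iff₀ (by positivity)] at this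
    have hpp : 0 < dist x c ^ p := Real.rpow_pos_of_pos hpos p
    have hple : dist x c ^ p ≤ dist x c := by
      have := Real.rpow_le_rpow_of_exponent_ge hpos hx1.le hp
      rwa [Real.rpow_one] at this
    have hlt : Metric.infDist x B < (M + 1) * dist x c ^ p := by
      have := hx hxG hpos
      nlinarith
    obtain ⟨b, hbB, hb⟩ := (Metric.infDist_lt_iff ⟨c, hc⟩).1 hlt
    have hbc : b ∈ Metric.ball c ε := by
      have h1 := dist_triangle_left b c x
      have h2 : (M + 1) * dist x c ^ p ≤ (M + 1) * dist x c := by gcongr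
      rw [Metric.mem_ball]
      linarith
    have hxc : x ∈ Metric.ball c ε := by
      rw [Metric.mem_ball]; nlinarith
    have h3 := hL.dist_le_mul x (hball hxc).2 b (hball hbc).2
    rw [hHB b ⟨hbB, (hball hbc).1⟩, Real.dist_eq, sub_zero] at h3
    calc |H x| ≤ L * dist x b := h3
      _ ≤ L * ((M + 1) * dist x c ^ p) := by gcongr
      _ = _ := by ring

/-! ### Graphs -/

/-- The horizontal embedding `PtDiff.adjP` as a continuous linear map. -/
noncomputable def adjPL (m : ℕ) : EuclideanSpace ℝ (Fin m) →L[ℝ] EuclideanSpace ℝ (Fin (m + 1)) :=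
  LinearMap.toContinuousLinearMap
    { toFun := PtDiff.adjP
      map_add' := fun x y => by
        ext i; refine Fin.lastCases ?_ (fun i => ?_) i <;> simp [PtDiff.adjP]
      map_smul' := fun c x => by
        ext i; refine Fin.lastCases ?_ (fun i => ?_) i <;> simp [PtDiff.adjP] }

/-- The vertical unit vector. -/
noncomputable def vertical (m : ℕ) : EuclideanSpace ℝ (Fin (m + 1)) :=
  EuclideanSpace.single (Fin.last m) 1

theorem adjPL_apply {m : ℕ} (x : EuclideanSpace ℝ (Fin m)) : adjPL m x = PtDiff.adjP x := rfl

theorem projP_adjPL_add {m : ℕ} (x : EuclideanSpace ℝ (Fin m)) (s : ℝ) :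
    PtDiff.projP (adjPL m x + s • vertical m) = x := by
  ext i; simp [PtDiff.projP, adjPL_apply, PtDiff.adjP, vertical]

theorem projQ_adjPL_add {m : ℕ} (x : EuclideanSpace ℝ (Fin m)) (s : ℝ) :
    PtDiff.projQ (adjPL m x + s • vertical m) = s := by
  simp [PtDiff.projQ, adjPL_apply, PtDiff.adjP, vertical]

theorem adjPL_projP_add {m : ℕ} (w : EuclideanSpace ℝ (Fin (m + 1))) :
    adjPL m (PtDiff.projP w) + PtDiff.projQ w • vertical m = w := by
  ext i
  refine Fin.lastCases ?_ (fun i => ?_) i <;>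
    simp [PtDiff.projP, PtDiff.projQ, adjPL_apply, PtDiff.adjP, vertical]

theorem norm_sq_eq_projP_projQ {m : ℕ} (w : EuclideanSpace ℝ (Fin (m + 1))) :
    ‖w‖ ^ 2 = ‖PtDiff.projP w‖ ^ 2 + PtDiff.projQ w ^ 2 := by
  rw [EuclideanSpace.norm_sq_eq, EuclideanSpace.norm_sq_eq, Fin.sum_univ_castSucc]
  simp [PtDiff.projP, PtDiff.projQ]

theorem norm_projP_le {m : ℕ} (w : EuclideanSpace ℝ (Fin (m + 1))) : ‖PtDiff.projP w‖ ≤ ‖w‖ :=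
  abs_le_of_sq_le_sq' (by rw [norm_sq_eq_projP_projQ w]; nlinarith) (norm_nonneg _) |>.2

theorem abs_projQ_le {m : ℕ} (w : EuclideanSpace ℝ (Fin (m + 1))) : |PtDiff.projQ w| ≤ ‖w‖ :=
  abs_le_of_sq_le_sq (by rw [norm_sq_eq_projP_projQ w]; nlinarith [sq_nonneg ‖PtDiff.projP w‖])
    (norm_nonneg _)

/-- Points above the graph of a function with vanishing derivative are at a distance of the order
of their height from the graph. -/
theorem eventually_half_le_infDist_graph {m : ℕ} {f : EuclideanSpace ℝ (Fin m) → ℝ}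
    {a : EuclideanSpace ℝ (Fin m)} (hfa : f a = 0)
    (hf : HasFDerivAt f (0 : EuclideanSpace ℝ (Fin m) →L[ℝ] ℝ) a) :
    ∀ᶠ r in 𝓝[>] (0 : ℝ), r / 2 ≤ Metric.infDist (adjPL m a + r • vertical m)
      {z : EuclideanSpace ℝ (Fin (m + 1)) | PtDiff.projQ z = f (PtDiff.projP z)} := by
  have h1 := (Asymptotics.isLittleO_iff.1 (hasFDerivAt_iff_isLittleO.1 hf)) one_pos
  obtain ⟨ε, hε, hev⟩ := Metric.eventually_nhds_iff.1 h1
  filter_upwards [Ioo_mem_nhdsGT hε] with r hr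
  refine (Metric.le_infDist ⟨adjPL m a + f a • vertical m, ?_⟩).2 fun z hz => ?_
  · rw [mem_ofPred_eq, projQ_adjPL_add, projP_adjPL_add]
  · rw [dist_comm, dist_eq_norm]
    have hz' : PtDiff.projQ z = f (PtDiff.projP z) := hz
    have hP : PtDiff.projP (z - (adjPL m a + r • vertical m)) = PtDiff.projP z - a := by
      conv_rhs => rw [← projP_adjPL_add a r]
      ext i; simp [PtDiff.projP]
    have hQ : PtDiff.projQ (z - (adjPL m a + r • vertical m)) = PtDiff.projQ z - r := by
      conv_rhs => rw [← projQ_adjPL_add a r]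
      simp [PtDiff.projQ]
    rcases le_or_gt (r / 2) ‖PtDiff.projP z - a‖ with h | h
    · refine h.trans ?_
      rw [← hP]; exact norm_projP_le _
    · refine le_trans ?_ (abs_projQ_le _)
      rw [hQ, hz']
      have h2 := hev (y := PtDiff.projP z) (by rw [dist_eq_norm]; linarith [hr.1, hr.2])
      rw [hfa, zero_apply, sub_zero, sub_zero, one_mul, Real.norm_eq_abs] at h2
      have h3 := neg_abs_le (f (PtDiff.projP z) - r)
      have h4 := le_abs_self (f (PtDiff.projP z))
      linarith

/-- If `f` vanishes to order `k` at `a` then pointwise differentiability of order `(k, α)` of its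
graph forces `f` to be of order `k + α` along lines. -/
theorem eventually_abs_le_of_pointwiseDifferentiable {k m : ℕ} (hk : 0 < k) {α : ℝ} (hα : 0 < α)
    {f : EuclideanSpace ℝ (Fin m) → ℝ} {a v : EuclideanSpace ℝ (Fin m)} (hfa : f a = 0)
    (hf : HasFDerivAt f (0 : EuclideanSpace ℝ (Fin m) →L[ℝ] ℝ) a)
    (hfv : (fun t : ℝ => f (a + t • v)) =o[𝓝 0] fun t => t ^ k)
    (hG : PtDiff.PointwiseDifferentiable k α
      {z : EuclideanSpace ℝ (Fin (m + 1)) | PtDiff.projQ z = f (PtDiff.projP z)}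
      (PtDiff.adjP a)) :
    ∃ K : ℝ, ∀ᶠ t in 𝓝[≠] (0 : ℝ), |f (a + t • v)| ≤ K * |t| ^ ((k : ℝ) + α) := by
  obtain ⟨-, d, B, hB, haB, htan, -, hlim⟩ := hG
  rw [← adjPL_apply] at haB htan hlim
  set G := {z : EuclideanSpace ℝ (Fin (m + 1)) | PtDiff.projQ z = f (PtDiff.projP z)} with hGdef
  have hk1 : (1 : ℝ) ≤ k := by exact_mod_cast hk
  have hmemG : ∀ y, adjPL m y + f y • vertical m ∈ G := fun y => by
    rw [hGdef, mem_ofPred_eq, projQ_adjPL_add, projP_adjPL_add]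
  have hlim' := hlim hα
  rw [show -(k : ℝ) - α = -((k : ℝ) + α) by ring] at hlim'
  obtain ⟨M, hM0, hM⟩ := exists_infDist_le_of_limsup_lt_top haB hlim'
  rcases hB.mem_nhds_or_exists_defining_function hk hα haB with hnhds | hdef
  · -- A set with interior is not tangent to a graph.
    exfalso
    obtain ⟨ε, hε, hball⟩ := Metric.mem_nhds_iff.1 hnhds
    have hcG : adjPL m a ∈ G := by simpa [hfa] using hmemG a
    have hnv : ‖vertical m‖ = 1 := by simp [vertical]
    have hev : ∀ᶠ r in 𝓝[>] (0 : ℝ), (1 : ℝ) / 2 ≤ r⁻¹ *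
        sSup ((fun x => |Metric.infDist x G - Metric.infDist x B|) ''
          Metric.closedBall (adjPL m a) r) := by
      filter_upwards [eventually_half_le_infDist_graph hfa hf, Ioo_mem_nhdsGT hε] with r hr hrε
      have hmem : adjPL m a + r • vertical m ∈ Metric.closedBall (adjPL m a) r := by
        simp [hnv, norm_smul, abs_of_pos hrε.1]
      have h1 : Metric.infDist (adjPL m a + r • vertical m) B = 0 := by
        refine Metric.infDist_zero_of_mem (hball ?_)
        simpa [hnv, norm_smul, abs_of_pos hrε.1] using hrε.2
      have hbdd : BddAbove ((fun x => |Metric.infDist x G - Metric.infDist x B|) ''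
          Metric.closedBall (adjPL m a) r) := by
        refine ⟨r, ?_⟩
        rintro _ ⟨x, hx, rfl⟩
        have h2 := (Metric.infDist_le_dist_of_mem hcG (x := x)).trans hx
        have h3 := (Metric.infDist_le_dist_of_mem haB (x := x)).trans hx
        exact abs_sub_le_of_nonneg_of_le Metric.infDist_nonneg h2 Metric.infDist_nonneg h3
      have h4 := le_csSup hbdd (mem_image_of_mem _ hmem)
      simp only [h1, sub_zero] at h4
      have h5 := hr.trans ((le_abs_self _).trans h4)
      rw [inv_mul_eq_div, le_div_iff₀ hrε.1]
      linarith
    have := ge_of_tendsto htan hev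
    norm_num at this
  · obtain ⟨H, U, hU, haU, hH, ⟨C, hC⟩, hD, hHB⟩ := hdef
    have hHs : HasStrictFDerivAt H (fderiv ℝ H (adjPL m a)) (adjPL m a) :=
      (hH.contDiffAt (hU.mem_nhds haU)).hasStrictFDerivAt (by exact_mod_cast hk.ne')
    obtain ⟨C', hC'⟩ := exists_abs_le_of_infDist_le haB (by linarith) hM0 hM hHs
      (hU.mem_nhds haU) hHB
    refine eventually_abs_le_of_defining_function hk hα (J := adjPL m) (e := vertical m)
      (fun w => ⟨_, _, (adjPL_projP_add w).symm⟩) hfa hf hfv hU haU hH hC hD (C' := C') ?_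
    have hcont : Tendsto (fun y => adjPL m y + f y • vertical m) (𝓝 a) (𝓝 (adjPL m a)) := by
      have : ContinuousAt (fun y => adjPL m y + f y • vertical m) a :=
        (adjPL m).continuous.continuousAt.add (hf.continuousAt.smul continuousAt_const)
      simpa [ContinuousAt, hfa] using this
    filter_upwards [hcont.eventually hC'] with y hy
    exact hy (hmemG y)

/-! ### Pullback of the example along a coordinate -/

theorem volume_preimage_coord_pos {m : ℕ} (i₀ : Fin m) {S : Set ℝ} (hS : 0 < volume S)
    (hSm : MeasurableSet S) :
    0 < volume ((fun x : EuclideanSpace ℝ (Fin m) => x i₀) ⁻¹' S) := by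
  have h1 : (fun x : EuclideanSpace ℝ (Fin m) => x i₀) ⁻¹' S
      = WithLp.ofLp ⁻¹' (univ.pi fun i => if i = i₀ then S else univ) := by
    ext x
    simp only [mem_preimage, mem_univ_pi]
    refine ⟨fun h i => ?_, fun h => by simpa using h i₀⟩
    by_cases hi : i = i₀
    · subst hi; simpa using h
    · simp [hi]
  rw [h1, (PiLp.volume_preserving_ofLp (Fin m)).measure_preimage
    (MeasurableSet.univ_pi fun i => by split_ifs <;> simp [hSm]).nullMeasurableSet, volume_pi_pi]
  refine pos_iff_ne_zero.2 (Finset.prod_ne_zero_iff.2 fun i _ => ?_)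
  split_ifs
  · exact hS.ne'
  · simp

theorem mainTheorem9 (k m : ℕ) (hk : 0 < k) (hm : 0 < m) :
    ∃ (A : Set (EuclideanSpace ℝ (Fin m))) (f : EuclideanSpace ℝ (Fin m) → ℝ),
      IsClosed A ∧ 0 < volume A ∧ (∀ x, 0 ≤ f x) ∧ ContDiff ℝ k f ∧
      (∀ a ∈ A, ∀ i ≤ k, iteratedFDeriv ℝ i f a = 0) ∧
      (∀ᵐ a ∂(volume : Measure (EuclideanSpace ℝ (Fin m))), a ∈ A →
        ∀ α : ℝ, 0 < α →
          limsup (fun x => ((‖x - a‖ ^ (-(k : ℝ) - α) * f x : ℝ) : EReal)) (𝓝[≠] a) = ⊤) ∧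
      (∀ α : ℝ, 0 < α → α ≤ 1 →
        ∀ᵐ c ∂(Measure.hausdorffMeasure (m : ℝ) : Measure (EuclideanSpace ℝ (Fin (m + 1)))),
          c ∈ PtDiff.adjP '' A →
            ¬ PtDiff.PointwiseDifferentiable k α
                {z : EuclideanSpace ℝ (Fin (m + 1)) | PtDiff.projQ z = f (PtDiff.projP z)} c) := by
  obtain ⟨S, g, hScl, hSpos, hg0, hg, hgS, hfreq⟩ := exists_isClosed_contDiff_frequently_lt k
  let i₀ : Fin m := ⟨0, hm⟩
  let π : EuclideanSpace ℝ (Fin m) →L[ℝ] ℝ := EuclideanSpace.proj i₀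
  let v : EuclideanSpace ℝ (Fin m) := EuclideanSpace.single i₀ 1
  have hπ : ∀ x, π x = x i₀ := fun x => rfl
  have hπv : ∀ (a : EuclideanSpace ℝ (Fin m)) (t : ℝ), π (a + t • v) = π a + t := fun a t => by
    rw [map_add, map_smul, hπ v]; simp [v]
  have hv : ‖v‖ = 1 := by simp [v]
  have hf : ContDiff ℝ k (g ∘ π) := hg.comp π.contDiff
  have hz : ∀ a ∈ π ⁻¹' S, ∀ i ≤ k, iteratedFDeriv ℝ i (g ∘ π) a = 0 := by
    intro a ha i hi
    rw [π.iteratedFDeriv_comp_right hg a (by exact_mod_cast hi)]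
    have h1 : iteratedFDeriv ℝ i g (π a) = 0 := by
      rw [← norm_eq_zero, norm_iteratedFDeriv_eq_norm_iteratedDeriv, hgS _ ha i hi, norm_zero]
    rw [h1]; ext; simp
  refine ⟨π ⁻¹' S, g ∘ π, hScl.preimage π.continuous,
    volume_preimage_coord_pos i₀ hSpos hScl.measurableSet, fun x => hg0 _, hf, hz, ?_, ?_⟩
  · refine Eventually.of_forall fun a ha α hα => (EReal.eq_top_iff_forall_lt _).2 fun C => ?_
    have hline : Tendsto (fun t : ℝ => a + t • v) (𝓝[≠] 0) (𝓝[≠] a) := by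
      refine tendsto_nhdsWithin_iff.2 ⟨?_, ?_⟩
      · have : Continuous fun t : ℝ => a + t • v := by fun_prop
        simpa using (this.tendsto 0).mono_left nhdsWithin_le_nhds
      · filter_upwards [self_mem_nhdsWithin] with t ht
        have : v ≠ 0 := norm_ne_zero_iff.1 (by rw [hv]; exact one_ne_zero)
        simpa [this] using ht
    have hfr : ∃ᶠ x in 𝓝[≠] a,
        ((C + 1 : ℝ) : EReal) ≤ ((‖x - a‖ ^ (-(k : ℝ) - α) * (g ∘ π) x : ℝ) : EReal) := by
      refine hline.frequently (((hfreq (π a) ha α hα (C + 1)).and_eventually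
        self_mem_nhdsWithin).mono fun t ht => ?_)
      have ht0 : 0 < |t| := abs_pos.2 ht.2
      rw [EReal.coe_le_coe_iff, add_sub_cancel_left, norm_smul, hv, mul_one, Real.norm_eq_abs,
        Function.comp_apply, hπv, show -(k : ℝ) - α = -((k : ℝ) + α) by ring,
        Real.rpow_neg ht0.le, inv_mul_eq_div, le_div_iff₀ (Real.rpow_pos_of_pos ht0 _)]
      exact ht.1.le
    refine lt_of_lt_of_le ?_ (le_limsup_of_frequently_le hfr)
    exact_mod_cast lt_add_one C
  · intro α hα _
    refine Eventually.of_forall ?_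
    rintro _ ⟨a, ha, rfl⟩ hG
    have hfa : (g ∘ π) a = 0 := by
      have := congrArg (fun T => T 0) (hz a ha 0 (Nat.zero_le k))
      simpa using this
    have hfd : HasFDerivAt (g ∘ π) (0 : EuclideanSpace ℝ (Fin m) →L[ℝ] ℝ) a := by
      have h1 : DifferentiableAt ℝ (g ∘ π) a :=
        hf.contDiffAt.differentiableAt (by exact_mod_cast hk.ne')
      have h2 : fderiv ℝ (g ∘ π) a = 0 := by
        rw [← norm_eq_zero, ← norm_iteratedFDeriv_one, hz a ha 1 hk, norm_zero]
      rw [← h2]; exact h1.hasFDerivAt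
    have hfv : (fun t : ℝ => (g ∘ π) (a + t • v)) =o[𝓝 0] fun t => t ^ k := by
      simp only [Function.comp_apply, hπv]
      exact isLittleO_pow_of_iteratedDeriv_eq_zero hg (hgS _ ha)
    obtain ⟨K, hK⟩ := eventually_abs_le_of_pointwiseDifferentiable hk hα hfa hfd hfv hG
    refine hfreq (π a) ha α hα K ?_
    filter_upwards [hK] with t ht
    rw [Function.comp_apply, hπv] at ht
    exact not_lt.2 ((le_abs_self _).trans ht)
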